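/- Let $k\ge 2$ be an integer, let $M$ be a compact smooth Riemannian manifold of dimension $m$ (without boundary), let $N$ be a smooth Riemannian manifold of dimension $n$ (without boundary) with positive injectivity radius, and let $f\colon M\to N$ be a continuous map. Let $-\tau M$ denote an inverse bundle of the tangent bundle $\tau M$, that is, a real vector bundle of finite rank over $M$ such that $\tau M\oplus(-\tau M)$ is isomorphic to the trivial vector bundle $M\times\mathbb{R}^{L}$, where $L=\dim\tau M+\dim(-\tau M)$. Let $\operatorname{Conf}(\mathbb{R}^L,k)$ be the space of $k$-tuples of pairwise distinct points of $\mathbb{R}^L$, with the symmetric group $\mathfrak{S}_k$ permuting the points, let $W_k=\{y\in\mathbb{R}^k:\sum_i y_i=0\}$ with $\mathfrak{S}_k$ permuting the coordinates, and let $\underline{W_k}$ be the trivial vector bundle over $M$ with fibre $W_k$. Let $p_1\colon M\times\operatorname{Conf}(\mathbb{R}^L,k)\to M$ be the projection, and let $\mathfrak{S}_k$ act on the total space of $p_1^*\big((f^*\tau N\oplus(-\tau M))\otimes_{\mathbb{R}}\underline{W_k}\big)$ diagonally, through its actions on $\operatorname{Conf}(\mathbb{R}^L,k)$ and $W_k$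 and trivially on $f^*\tau N\oplus(-\tau M)$. Suppose that the quotient vector bundle $$E\big(p_1^*((f^*\tau N\oplus(-\tau M))\otimes_{\mathbb{R}}\underline{W_k})\big)/\mathfrak{S}_k\longrightarrow M\times\operatorname{Conf}(\mathbb{R}^L,k)/\mathfrak{S}_k$$ does not admit a continuous nowhere zero section. Then $f$ admits a local $k$-multiplicity: for every real number $\omega>0$ there exist $k$ pairwise distinct points $x_1,\dots,x_k\in M$ such that $f(x_1)=\cdots=f(x_k)$ and $\operatorname{diam}\{x_1,\dots,x_k\}<\omega$, where the diameter is taken with respect to the Riemannian distance of $M$ (which is infinite between different components). -/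

import Mathlib

open Bundle Manifold Set Topology
open scoped ContDiff ENNReal TensorProduct

noncomputable section

namespace LocalMultiplicity

/-! ### Multiplicities -/

/-- The map `f` admits a local `k`-multiplicity: for every `r > 0` there are `k` pairwise distinct
points with the same value and with diameter less than `r`. -/
def AdmitsLocalMultiplicity {M N : Type*} [EMetricSpace M] (k : ℕ) (f : M → N) : Prop :=
  ∀ r : ℝ, 0 < r → ∃ x : Fin k → M, Function.Injective x ∧ (∀ i j, f (x i) = f (x j)) ∧
    Metric.ediam (Set.range x) < ENNReal.ofReal r

/-! ### Geodesics, the exponential map and the injectivity radius -/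

section Riemannian

variable {E : Type*} [NormedAddCommGroup E] [NormedSpace ℝ E]
  {H : Type*} [TopologicalSpace H] (I : ModelWithCorners ℝ E H)
  {M : Type*} [TopologicalSpace M] [ChartedSpace H M] [IsManifold I ∞ M]
  [RiemannianBundle (fun x : M ↦ TangentSpace I x)]

/-- The Riemannian metric read in the preferred chart `φ` at `p`, at the point `y` of the model
space: the inner product of the images of `u` and `v` under the derivative of `φ⁻¹` at `y`
(in coordinates, `∑ i j, g_ij(y) u_i v_j`). Used for manifolds without boundary. -/
def metricInChart (p : M) (y u v : E) : ℝ :=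
  inner ℝ
    (mfderivWithin 𝓘(ℝ, E) I (extChartAt I p).symm (Set.range I) y u :
      TangentSpace I ((extChartAt I p).symm y))
    (mfderivWithin 𝓘(ℝ, E) I (extChartAt I p).symm (Set.range I) y v :
      TangentSpace I ((extChartAt I p).symm y))

/-- A curve `γ`, smooth on the open set `s` of times, is a geodesic on `s` if, in the charts of the
manifold, it satisfies the geodesic equation. The equation is written here as the Euler-Lagrange
equation of the energy `∫ g_c(c', c')`: with `c` the curve and `g` the metric in the chart,
`d/dt (2 g_c(c', w)) = (∂_w g)_c(c', c')` for every vector `w`. Expanding the left-hand side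
gives `c'' + Γ_c(c', c') = 0` with `Γ` the Christoffel symbols of the Levi-Civita connection. -/
def IsGeodesicOn (γ : ℝ → M) (s : Set ℝ) : Prop :=
  ContMDiffOn 𝓘(ℝ, ℝ) I ∞ γ s ∧
  ∀ t ∈ s, ∀ w : E,
    let c : ℝ → E := fun τ ↦ extChartAt I (γ t) (γ τ)
    HasDerivAt (fun τ ↦ 2 * metricInChart I (γ t) (c τ) (deriv c τ) w)
      (fderiv ℝ (fun y ↦ metricInChart I (γ t) y (deriv c t) (deriv c t)) (c t) w) t

/-- `exp_x v` is defined and equal to `y`: there is a geodesic, defined on an open interval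
containing `[0, 1]`, that starts at `x` with velocity `v` and is at `y` at time `1`. -/
def IsExp (x : M) (v : TangentSpace I x) (y : M) : Prop :=
  ∃ (γ : ℝ → M) (ε : ℝ), 0 < ε ∧ IsGeodesicOn I γ (Set.Ioo (-ε) (1 + ε)) ∧
    (⟨γ 0, mfderiv 𝓘(ℝ, ℝ) I γ 0 (1 : ℝ)⟩ : TangentBundle I M) = ⟨x, v⟩ ∧ γ 1 = y

/-- The open ball of radius `r` around `0` in the tangent space at `x`, for the Riemannian norm. -/
def tangentBall (x : M) (r : ℝ≥0∞) : Set (TangentSpace I x) :=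
  {v | ‖v‖ₑ < r}

/-- The exponential map at `x` is defined on the open ball of radius `r` around `0`, and is a
diffeomorphism (an injective local diffeomorphism) from this ball onto its image. -/
def ExpIsDiffeoOnBall (x : M) (r : ℝ≥0∞) : Prop :=
  ∃ e : E → M, (∀ v ∈ tangentBall I x r, IsExp I x v (e v)) ∧
    Set.InjOn e (tangentBall I x r) ∧
    IsLocalDiffeomorphOn 𝓘(ℝ, E) I ∞ e (tangentBall I x r)

/-- The injectivity radius at `x`: the supremum of the radii `r` such that the exponential map
at `x` is a diffeomorphism from the open ball of radius `r` onto its image. -/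
def injectivityRadiusAt (x : M) : ℝ≥0∞ :=
  sSup {r | ExpIsDiffeoOnBall I x r}

variable (M) in
/-- The injectivity radius of a Riemannian manifold. -/
def injectivityRadius : ℝ≥0∞ :=
  ⨅ x : M, injectivityRadiusAt I x

end Riemannian

/-! ### Configuration spaces and the representation `W_k` -/

/-- The configuration space of `k` ordered pairwise distinct points in `X`, a subspace
of `X ^ k`. -/
def Conf (X : Type*) (k : ℕ) : Type _ :=
  {c : Fin k → X // Function.Injective c}

instance (X : Type*) [TopologicalSpace X] (k : ℕ) : TopologicalSpace (Conf X k) :=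
  instTopologicalSpaceSubtype

/-- The symmetric group permutes the points of a configuration. -/
instance (X : Type*) (k : ℕ) : MulAction (Equiv.Perm (Fin k)) (Conf X k) where
  smul σ c := ⟨fun i ↦ c.1 (σ⁻¹ i), c.2.comp (σ⁻¹).injective⟩
  one_smul _ := rfl
  mul_smul _ _ _ := rfl

/-- The space `W_k` of vectors in `ℝ ^ k` with vanishing sum of coordinates. -/
def W (k : ℕ) : Submodule ℝ (Fin k → ℝ) where
  carrier := {y | ∑ i, y i = 0}
  zero_mem' := by simp
  add_mem' {a b} ha hb := by
    simp only [Set.mem_ofPred_eq, Pi.add_apply, Finset.sum_add_distrib] at *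
    rw [ha, hb, add_zero]
  smul_mem' r a ha := by
    simp only [Set.mem_ofPred_eq, Pi.smul_apply, smul_eq_mul, ← Finset.mul_sum] at *
    rw [ha, mul_zero]

/-- The representation of the symmetric group on `W_k` by permutation of the coordinates. -/
def permW (k : ℕ) : Representation ℝ (Equiv.Perm (Fin k)) (W k) where
  toFun σ :=
    { toFun := fun y ↦ ⟨fun i ↦ y.1 (σ⁻¹ i), (Equiv.sum_comp σ⁻¹ y.1).trans y.2⟩
      map_add' := fun _ _ ↦ rfl
      map_smul' := fun _ _ ↦ rfl }
  map_one' := rfl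
  map_mul' _ _ := rfl

/-- The `i`-th coordinate as a linear form on `W_k`. -/
def coordW (k : ℕ) (i : Fin k) : W k →ₗ[ℝ] ℝ :=
  (LinearMap.proj i).comp (W k).subtype

/-! ### The bundles -/

section Bundles

variable {X : Type*} (k : ℕ) (V : X → Type*) [∀ x, AddCommMonoid (V x)] [∀ x, Module ℝ (V x)]

/-- The fibres `V_x ⊗ W_k` of the tensor product of the vector bundle `V` with the trivial vector
bundle with fibre `W_k`. -/
abbrev TensorW (x : X) : Type _ := V x ⊗[ℝ] W k

/-- The `i`-th coordinate `V_x ⊗ W_k → V_x ⊗ ℝ = V_x` of an element of `V_x ⊗ W_k`. -/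
def tensorCoord (x : X) (i : Fin k) : TensorW k V x →ₗ[ℝ] V x :=
  (TensorProduct.rid ℝ (V x)).toLinearMap.comp ((coordW k i).lTensor (V x))

variable (F : Type*) [AddCommMonoid F] [Module ℝ F]

/-- The topology on the total space of the vector bundle `V ⊗ W_k`: the subspace topology for the
inclusion of `V ⊗ W_k` in `V ⊗ ℝ ^ k`, that is, in the `k`-fold Whitney sum of `V`,
whose total space is a subspace of the `k`-th power of the total space of `V`. -/
instance [TopologicalSpace X] [TopologicalSpace (TotalSpace F V)] :
    TopologicalSpace (TotalSpace (F ⊗[ℝ] W k) (TensorW k V)) :=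
  TopologicalSpace.induced
    (fun p ↦ (p.proj, fun i ↦ (⟨p.proj, tensorCoord k V p.proj i p.snd⟩ : TotalSpace F V)))
    (inferInstance : TopologicalSpace (X × (Fin k → TotalSpace F V)))

variable (Y : Type*)

/-- The total space of `p₁^*(V ⊗ W_k)`, for the projection `p₁ : X × Conf(Y, k) → X`. -/
abbrev PullbackTotal : Type _ :=
  TotalSpace (F ⊗[ℝ] W k) ((Prod.fst : X × Conf Y k → X) *ᵖ (TensorW k V))

variable {k V F Y} in
theorem PullbackTotal.mk_eq {x : X} {c c' : Conf Y k} {t t' : TensorW k V x} (hc : c = c')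
    (ht : t = t') : (⟨(x, c), t⟩ : PullbackTotal k V F Y) = ⟨(x, c'), t'⟩ := by
  subst hc; subst ht; rfl

/-- The diagonal action of the symmetric group on the total space of `p₁^*(V ⊗ W_k)`: trivial
on `V`, by permutations on configurations and on `W_k`. -/
instance : MulAction (Equiv.Perm (Fin k)) (PullbackTotal k V F Y) where
  smul σ p := ⟨(p.proj.1, σ • p.proj.2), (permW k σ).lTensor (V p.proj.1) p.snd⟩
  one_smul := by
    rintro ⟨⟨x, c⟩, t⟩
    refine PullbackTotal.mk_eq (one_smul _ c) ?_
    have h (u : TensorW k V x) : (permW k 1).lTensor (V x) u = u := by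
      rw [map_one]
      exact LinearMap.congr_fun (LinearMap.lTensor_id (V x) (W k)) u
    exact h t
  mul_smul := by
    rintro σ τ ⟨⟨x, c⟩, t⟩
    refine PullbackTotal.mk_eq (mul_smul σ τ c) ?_
    have h (u : TensorW k V x) : (permW k (σ * τ)).lTensor (V x) u =
        (permW k σ).lTensor (V x) ((permW k τ).lTensor (V x) u) := by
      rw [map_mul]
      exact LinearMap.congr_fun (LinearMap.lTensor_comp (V x) (permW k σ) (permW k τ)) u
    exact h t

/-- The total space of the quotient bundle `p₁^*(V ⊗ W_k) / S_k`, with the quotient topology. -/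
abbrev QuotientTotal : Type _ :=
  MulAction.orbitRel.Quotient (Equiv.Perm (Fin k)) (PullbackTotal k V F Y)

/-- The unordered configuration space `Conf(Y, k) / S_k`, with the quotient topology. -/
abbrev UConf (Y : Type*) (k : ℕ) : Type _ :=
  MulAction.orbitRel.Quotient (Equiv.Perm (Fin k)) (Conf Y k)

variable {k V F Y} in
/-- The projection of the quotient bundle `p₁^*(V ⊗ W_k) / S_k → X × Conf(Y, k) / S_k`. -/
def QuotientTotal.proj (p : QuotientTotal k V F Y) : X × UConf Y k :=
  Quotient.lift (fun q : PullbackTotal k V F Y ↦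
      ((q.proj.1, Quotient.mk _ q.proj.2) : X × UConf Y k))
    (by
      rintro q q' ⟨σ, rfl⟩
      exact Prod.ext rfl (Quotient.sound ⟨σ, rfl⟩)) p

/-- The point of the quotient bundle that is represented by the zero vector over `(x, c)`. -/
def QuotientTotal.zero (x : X) (c : Conf Y k) : QuotientTotal k V F Y :=
  Quotient.mk _ (⟨(x, c), (0 : TensorW k V x)⟩ : PullbackTotal k V F Y)

/-- The quotient bundle `p₁^*(V ⊗ W_k) / S_k → X × Conf(Y, k) / S_k` has a (continuous) section
that vanishes nowhere. -/
def HasNowhereZeroSection [TopologicalSpace X] [TopologicalSpace (TotalSpace F V)]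
    [TopologicalSpace Y] : Prop :=
  ∃ s : X × UConf Y k → QuotientTotal k V F Y, Continuous s ∧ (∀ b, (s b).proj = b) ∧
    ∀ b x c, s b ≠ QuotientTotal.zero k V F Y x c

end Bundles

/-- The vector bundle `ζ` is an inverse of the vector bundle `ξ`: the Whitney sum `ξ ⊕ ζ` is
isomorphic to the trivial vector bundle with fibre `ℝ ^ L`. -/
def IsInverseBundle (L : ℕ) {X : Type*} [TopologicalSpace X]
    (F₁ : Type*) [NormedAddCommGroup F₁] [NormedSpace ℝ F₁] (ξ : X → Type*)
    [∀ x, AddCommMonoid (ξ x)] [∀ x, Module ℝ (ξ x)] [TopologicalSpace (TotalSpace F₁ ξ)]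
    (F₂ : Type*) [NormedAddCommGroup F₂] [NormedSpace ℝ F₂] (ζ : X → Type*)
    [∀ x, AddCommMonoid (ζ x)] [∀ x, Module ℝ (ζ x)] [TopologicalSpace (TotalSpace F₂ ζ)] : Prop :=
  ∃ Θ : TotalSpace (F₁ × F₂) (ξ ×ᵇ ζ) ≃ₜ
      X × EuclideanSpace ℝ (Fin L),
    (∀ p, (Θ p).1 = p.proj) ∧
    ∀ x, IsLinearMap ℝ (fun v : (ξ ×ᵇ ζ) x ↦ (Θ ⟨x, v⟩).2)

end LocalMultiplicity

end

/-!
The contrapositive is proved: if, for some `r > 0`, no `k` distinct points of diameter less than `r`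
have the same image under `f`, then the bundle has a nowhere zero section.

The local geometry enters through families of maps `Φ_x : N → T_{f x} N`, for `x` in the compact
space `M`, that vanish at `f x`, depend continuously on `x`, and near `f x` are injective and onto a
neighbourhood of `0`, uniformly in `x` (`IsFibrewiseCoord`). An inverse of the exponential map at
`f x` is such a family, but a first-order substitute is enough: with a partition of unity `ρ_i` on
`M` subordinate to the preimages of finitely many charts `φ_i` of `N`, put
`Φ_x z = ∑ i, ρ_i x • D(φ_i)⁻¹ (φ_i z - φ_i (f x))`. In the chart at `f x₀`, the difference
`Φ_x z - Φ_x z'` is the difference of the coordinates of `z` and `z'` up to a relative error that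
tends to `0` as `(x, z, z')` tends to `(x₀, f x₀, f x₀)`
(`chartDiff_sub_chartDiff_isLittleO`). Injectivity follows at once, and surjectivity onto a
neighbourhood of `0` by the contraction argument of the inverse function theorem
(`exists_isFibrewiseCoord_tangentSpace`).

The same construction for the identity of `M` gives maps `Ψ_x : M → T_x M`. By compactness of `M`
they are injective on the balls of some radius `δ < r / 2`, and all sufficiently short tangent
vectors `v` at `x` are `Ψ_x z` for a unique `z` in this ball, which depends continuously on `v`
(`exists_continuousOn_inverse`): so `v ↦ z` plays the role of the exponential map of `M`.

Now let `c` be a configuration in `ℝ ^ L = T_x M ⊕ ζ_x`, rescaled so that its points `(v_i, w_i)`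
are short, let `z_i` be the point of `M` with `Ψ_x z_i = v_i`, and take the vectors
`(Φ_x (f z_i), w_i)` of `T_{f x} N ⊕ ζ_x`. They depend equivariantly on `c`. If all of them were
equal, then so would be the `w_i` and the `f z_i`; hence the `v_i`, and with them the `z_i`, would
be pairwise distinct, and the `z_i` would be `k` points of diameter less than `r` with the same image.
So they are not all equal, and subtracting their mean gives a nonzero element of
`(T_{f x} N ⊕ ζ_x) ⊗ W_k`, which is the value of the section at `(x, c)`
(`hasNowhereZeroSection_of_equivariant`, `admitsLocalMultiplicity_of_isFibrewiseCoord`).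
-/

namespace LocalMultiplicity
open Filter Asymptotics

/-! ### Vector bundles and fibrewise coordinates -/

theorem t2Space_totalSpace {B F : Type*} [TopologicalSpace B] [TopologicalSpace F]
    {V : B → Type*} [∀ x, TopologicalSpace (V x)] [TopologicalSpace (TotalSpace F V)]
    [FiberBundle F V] [T2Space B] [T2Space F] : T2Space (TotalSpace F V) := by
  refine ⟨fun p q hpq ↦ ?_⟩
  by_cases h : p.proj = q.proj
  · set e := trivializationAt F V p.proj
    have hp : p ∈ e.source := FiberBundle.mem_trivializationAt_proj_source
    have hq : q ∈ e.source := by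
      rw [e.mem_source, ← h]
      exact e.mem_source.1 hp
    obtain ⟨u, v, hu, hv, hpu, hqv, huv⟩ := t2_separation fun h ↦ hpq (e.injOn hp hq h)
    exact ⟨e.source ∩ e ⁻¹' u, e.source ∩ e ⁻¹' v,
      e.toOpenPartialHomeomorph.isOpen_inter_preimage hu,
      e.toOpenPartialHomeomorph.isOpen_inter_preimage hv, ⟨hp, hpu⟩, ⟨hq, hqv⟩,
      (huv.preimage e).mono inter_subset_right inter_subset_right⟩
  · obtain ⟨u, v, hu, hv, hpu, hqv, huv⟩ := t2_separation h
    have hc := FiberBundle.continuous_proj F V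
    exact ⟨_, _, hu.preimage hc, hv.preimage hc, hpu, hqv, huv.preimage _⟩

section VectorBundle

variable {B F : Type*} [TopologicalSpace B] [NormedAddCommGroup F] [NormedSpace ℝ F]
  {V : B → Type*} [∀ x, AddCommMonoid (V x)] [∀ x, Module ℝ (V x)] [∀ x, TopologicalSpace (V x)]
  [TopologicalSpace (TotalSpace F V)] [FiberBundle F V] [VectorBundle ℝ F V]

theorem continuousAt_totalSpace_sum {ι Y : Type*} [TopologicalSpace Y] (s : Finset ι) (a : ι → ℝ)
    {b : Y → B} {g : ι → ∀ y, V (b y)} {y₀ : Y} (hb : ContinuousAt b y₀)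
    (hg : ∀ i ∈ s, ContinuousAt (fun y ↦ (⟨b y, g i y⟩ : TotalSpace F V)) y₀) :
    ContinuousAt (fun y ↦ (⟨b y, ∑ i ∈ s, a i • g i y⟩ : TotalSpace F V)) y₀ := by
  rw [FiberBundle.continuousAt_totalSpace]
  refine ⟨hb, ?_⟩
  set e := trivializationAt F V (b y₀)
  have hmem : ∀ᶠ y in 𝓝 y₀, b y ∈ e.baseSet :=
    hb.eventually (e.open_baseSet.mem_nhds (FiberBundle.mem_baseSet_trivializationAt' _))
  have h : ContinuousAt (fun y ↦ ∑ i ∈ s, a i • (e ⟨b y, g i y⟩).2) y₀ :=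
    tendsto_finsetSum _ fun i hi ↦
      ((FiberBundle.continuousAt_totalSpace F _).1 (hg i hi)).2.const_smul (a i)
  refine h.congr ?_
  filter_upwards [hmem] with y hy
  simp_rw [← e.continuousLinearMapAt_apply_of_mem (R := ℝ) hy, map_sum, map_smul]

/-- The maps `Ψ x : B → V (b x)`, indexed by `x : X`, are coordinates of `B` centred at `b x` with
values in the fibres of `V`: near the graph of `b` they are jointly continuous, injective for fixed
`x`, and jointly onto a neighbourhood of the zero vectors. No condition is imposed away from the
graph of `b`. For an inverse of an exponential map one takes for `V` the tangent bundle of `B`. -/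
structure IsFibrewiseCoord (F : Type*) [NormedAddCommGroup F] [NormedSpace ℝ F]
    {V : B → Type*} [∀ x, AddCommGroup (V x)] [TopologicalSpace (TotalSpace F V)]
    {X : Type*} [TopologicalSpace X] (b : X → B) (Ψ : ∀ x, B → V (b x)) : Prop where
  eventually_continuousAt : ∀ x, ∀ᶠ q : X × B in 𝓝 (x, b x),
    ContinuousAt (fun q : X × B ↦ (⟨b q.1, Ψ q.1 q.2⟩ : TotalSpace F V)) q
  eventually_injective : ∀ x, ∀ᶠ q : X × B × B in 𝓝 (x, b x, b x),
    Ψ q.1 q.2.1 = Ψ q.1 q.2.2 → q.2.1 = q.2.2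
  eventually_exists_eq : ∀ x, ∀ O ∈ 𝓝 (x, b x),
    ∀ᶠ q : X × TotalSpace F V in 𝓝 (x, ⟨b x, 0⟩), q.2.proj = b q.1 →
      ∃ z, (q.1, z) ∈ O ∧ (⟨b q.1, Ψ q.1 z⟩ : TotalSpace F V) = q.2

end VectorBundle

/-! ### Averaged chart differences -/

section Manifold

variable {E : Type*} [NormedAddCommGroup E] [NormedSpace ℝ E]
  {H : Type*} [TopologicalSpace H] (I : ModelWithCorners ℝ E H)
  {N : Type*} [TopologicalSpace N] [ChartedSpace H N] [IsManifold I 1 N]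
  {X ι : Type*} [TopologicalSpace X] [Fintype ι]

/-- A quantitative surjectivity statement: a map that is uniformly close to the identity on a ball
attains all small values there if it vanishes near the centre. -/
theorem exists_eq_of_norm_sub_sub_le [CompleteSpace E] {h : E → E} {r : ℝ} (hr : 0 < r) {c b v : E}
    (hh : ∀ u ∈ Metric.closedBall c r, ∀ u' ∈ Metric.closedBall c r,
      ‖h u - h u' - (u - u')‖ ≤ 1 / 2 * ‖u - u'‖)
    (hb : b ∈ Metric.closedBall c (r / 2)) (hb0 : h b = 0)
    (hv : v ∈ Metric.closedBall (0 : E) (r / 4)) :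
    ∃ u ∈ Metric.closedBall c r, h u = v := by
  have hsub : Metric.closedBall b (r / 2) ⊆ Metric.closedBall c r :=
    Metric.closedBall_subset_closedBall' (by rw [Metric.mem_closedBall] at hb; linarith)
  have happ : ApproximatesLinearOn h (.id ℝ E) (Metric.closedBall c r) (1 / 2) := by
    intro u hu u' hu'
    simpa using hh u hu u' hu'
  obtain ⟨u, hu, huv⟩ := happ.surjOn_closedBall_of_nonlinearRightInverse
    { toFun := id, nnnorm := 1, bound' := by simp, right_inv' := fun _ ↦ rfl } (half_pos hr).le
    hsub (a := v) (by
      rw [hb0]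
      convert! hv using 2
      norm_num
      ring)
  exact ⟨u, hsub hu, huv⟩

theorem isLittleO_clm_apply_of_isBigO {α : Type*} {l : Filter α} {A : α → E →L[ℝ] E}
    {u g : α → E} (hA : A =O[l] fun _ ↦ (1 : ℝ)) (hu : u =o[l] g) :
    (fun a ↦ A a (u a)) =o[l] g := by
  have h : (fun a ↦ ‖A a‖ * ‖u a‖) =o[l] fun a ↦ (1 : ℝ) * ‖g a‖ :=
    hA.norm_left.mul_isLittleO hu.norm_norm
  simp only [one_mul] at h
  exact (IsBigO.of_norm_le fun a ↦ (A a).le_opNorm (u a)).trans_isLittleO h.of_norm_right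

theorem isLittleO_clm_apply_of_isLittleO {α : Type*} {l : Filter α} {A : α → E →L[ℝ] E}
    {u g : α → E} (hA : A =o[l] fun _ ↦ (1 : ℝ)) (hu : u =O[l] g) :
    (fun a ↦ A a (u a)) =o[l] g := by
  have h : (fun a ↦ ‖A a‖ * ‖u a‖) =o[l] fun a ↦ (1 : ℝ) * ‖g a‖ :=
    hA.norm_left.mul_isBigO hu.norm_norm
  simp only [one_mul] at h
  exact (IsBigO.of_norm_le fun a ↦ (A a).le_opNorm (u a)).trans_isLittleO h.of_norm_right

/-- The average `∑ i, ρ i x • D(φ_i)⁻¹ (φ_i z - φ_i (f x))` of the coordinate differences of `z` and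
`f x` in the charts `φ_i` at `p i`, as a tangent vector at `f x`. The inverse of `D(φ_i)` at `f x`
is the inverse trivialization of the tangent bundle; outside the source of `φ_i` it is a junk value,
which does no harm if `ρ i` is supported where `f x` lies in this source. -/
noncomputable def chartDiff (f : X → N) (p : ι → N) (ρ : ι → X → ℝ) (x : X) (z : N) :
    TangentSpace I (f x) :=
  ∑ i, (trivializationAt E (TangentSpace I) (p i)).symmL ℝ (f x)
    (ρ i x • (extChartAt I (p i) z - extChartAt I (p i) (f x)))

variable {f : X → N} {p : ι → N} {ρ : ι → X → ℝ}

theorem continuousLinearMapAt_symmL_eq {p q y : N} (hp : y ∈ (chartAt H p).source)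
    (hq : y ∈ (chartAt H q).source) (v : E) :
    (trivializationAt E (TangentSpace I) q).continuousLinearMapAt ℝ y
      ((trivializationAt E (TangentSpace I) p).symmL ℝ y v) = tangentCoordChange I p q y v := by
  rw [TangentBundle.continuousLinearMapAt_trivializationAt_eq_core hq,
    TangentBundle.symmL_trivializationAt_eq_core hp]
  apply tangentCoordChange_comp
  simp only [extChartAt_source]
  exact ⟨⟨hp, mem_chart_source H y⟩, hq⟩

/-- Near `(x, f x)`, a term of `chartDiff` either is identically zero or involves only points in the
source of the corresponding chart. -/
theorem continuousAt_chartDiff (hf : Continuous f) (hρ : ∀ i, Continuous (ρ i))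
    (hsub : ∀ i, tsupport (ρ i) ⊆ f ⁻¹' (chartAt H (p i)).source) (x : X) :
    ∀ᶠ q : X × N in 𝓝 (x, f x), ContinuousAt
      (fun q : X × N ↦ (⟨f q.1, chartDiff I f p ρ q.1 q.2⟩ : TangentBundle I N)) q := by
  have key (i : ι) : ∀ᶠ q : X × N in 𝓝 (x, f x), ContinuousAt
      (fun q : X × N ↦ (⟨f q.1, (trivializationAt E (TangentSpace I) (p i)).symmL ℝ (f q.1)
        (ρ i q.1 • (extChartAt I (p i) q.2 - extChartAt I (p i) (f q.1)))⟩ :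
          TangentBundle I N)) q := by
    by_cases hx : x ∈ tsupport (ρ i)
    · have hs := (chartAt H (p i)).open_source
      have h1 : ∀ᶠ q : X × N in 𝓝 (x, f x), f q.1 ∈ (chartAt H (p i)).source :=
        (hf.comp continuous_fst).continuousAt.eventually (hs.mem_nhds (hsub i hx))
      have h2 : ∀ᶠ q : X × N in 𝓝 (x, f x), q.2 ∈ (chartAt H (p i)).source :=
        continuous_snd.continuousAt.eventually (hs.mem_nhds (hsub i hx))
      filter_upwards [h1.eventually_nhds, h2.eventually_nhds] with q hq1 hq2
      have hc : ContinuousAt (fun q : X × N ↦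
          (f q.1, ρ i q.1 • (extChartAt I (p i) q.2 - extChartAt I (p i) (f q.1)))) q := by
        refine (hf.comp continuous_fst).continuousAt.prodMk
          (((hρ i).comp continuous_fst).continuousAt.smul (.sub ?_ ?_))
        · exact (continuousAt_extChartAt' (I := I) (x := p i)
            (by simpa using hq2.self_of_nhds)).comp continuous_snd.continuousAt
        · exact ContinuousAt.comp (f := fun q : X × N ↦ f q.1)
            (continuousAt_extChartAt' (I := I) (x := p i) (by simpa using hq1.self_of_nhds))
            (hf.comp continuous_fst).continuousAt
      have hs' := (trivializationAt E (TangentSpace I) (p i)).continuousOn_symm.continuousAt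
        (x := (f q.1, ρ i q.1 • (extChartAt I (p i) q.2 - extChartAt I (p i) (f q.1))))
        (((trivializationAt E (TangentSpace I) (p i)).open_baseSet.prod isOpen_univ).mem_nhds
          ⟨hq1.self_of_nhds, trivial⟩)
      refine (ContinuousAt.comp (f := fun q : X × N ↦
          (f q.1, ρ i q.1 • (extChartAt I (p i) q.2 - extChartAt I (p i) (f q.1))))
        hs' hc).congr ?_
      filter_upwards [hq1] with q' hq'
      simp only [Function.comp_apply]
      rw [Trivialization.symmL_apply _ (by exact hq')]
    · have h0 : ∀ᶠ q : X × N in 𝓝 (x, f x), q.1 ∉ tsupport (ρ i) :=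
        ((isClosed_tsupport (ρ i)).isOpen_compl.preimage continuous_fst).mem_nhds hx
      filter_upwards [h0.eventually_nhds] with q hq
      refine (((Bundle.Trivialization.continuous_zeroSection ℝ (F := E)
        (E := (TangentSpace I : N → Type _))).comp (hf.comp continuous_fst)).continuousAt
          (x := q)).congr ?_
      filter_upwards [hq] with q' hq'
      simp [zeroSection, image_eq_zero_of_notMem_tsupport hq']
  filter_upwards [eventually_all.2 key] with q hq
  have := continuousAt_totalSpace_sum (F := E) (V := (TangentSpace I : N → Type _)) Finset.univ 1
    (hf.comp continuous_fst).continuousAt fun i _ ↦ hq i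
  simpa [chartDiff] using this

/-- Strict differentiability of the transition maps: coordinate differences in the chart at `p`,
carried by the derivative of the transition map at a nearby point, are to first order the
coordinate differences in the chart at `y₀`. -/
theorem tangentCoordChange_sub_isLittleO [I.Boundaryless] {p y₀ : N}
    (hp : y₀ ∈ (extChartAt I p).source) :
    (fun q : N × N × N ↦ tangentCoordChange I p y₀ q.1
        (extChartAt I p q.2.1 - extChartAt I p q.2.2) -
        (extChartAt I y₀ q.2.1 - extChartAt I y₀ q.2.2)) =o[𝓝 (y₀, y₀, y₀)]
      fun q ↦ extChartAt I y₀ q.2.1 - extChartAt I y₀ q.2.2 := by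
  set φ := extChartAt I y₀
  set ψ := extChartAt I p
  set T := tangentCoordChange I y₀ p y₀ with hT
  set A := tangentCoordChange I p y₀ with hA
  have hy₀ : y₀ ∈ φ.source := mem_extChartAt_source y₀
  have hφ : φ.source ∈ 𝓝 y₀ := extChartAt_source_mem_nhds y₀
  have hf1 : Tendsto (fun q : N × N × N ↦ q.1) (𝓝 (y₀, y₀, y₀)) (𝓝 y₀) :=
    continuous_fst.continuousAt
  have hf2 : Tendsto (fun q : N × N × N ↦ q.2.1) (𝓝 (y₀, y₀, y₀)) (𝓝 y₀) :=
    (continuous_fst.comp continuous_snd).continuousAt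
  have hf3 : Tendsto (fun q : N × N × N ↦ q.2.2) (𝓝 (y₀, y₀, y₀)) (𝓝 y₀) :=
    (continuous_snd.comp continuous_snd).continuousAt
  have hstrict : HasStrictFDerivAt (ψ ∘ φ.symm) T (φ y₀) := by
    have hcd : ContDiffAt ℝ 1 (ψ ∘ φ.symm) (φ y₀) := by
      have := contDiffWithinAt_ext_coord_change (I := I) (n := 1) p y₀ (y := φ y₀) (by
        rw [PartialEquiv.trans_source'', PartialEquiv.symm_symm, PartialEquiv.symm_target]
        exact mem_image_of_mem _ ⟨hy₀, hp⟩)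
      rwa [I.range_eq_univ, contDiffWithinAt_univ] at this
    refine hcd.hasStrictFDerivAt' ?_ one_ne_zero
    have := hasFDerivWithinAt_tangentCoordChange (I := I) (x := y₀) (y := p) (z := y₀) ⟨hy₀, hp⟩
    rwa [I.range_eq_univ, hasFDerivWithinAt_univ] at this
  have hφc : Tendsto φ (𝓝 y₀) (𝓝 (φ y₀)) := continuousAt_extChartAt y₀
  have hl : (fun q : N × N × N ↦ ψ q.2.1 - ψ q.2.2 - T (φ q.2.1 - φ q.2.2))
      =o[𝓝 (y₀, y₀, y₀)] fun q ↦ φ q.2.1 - φ q.2.2 := by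
    refine (hstrict.isLittleO.comp_tendsto
      ((hφc.comp hf2).prodMk_nhds (hφc.comp hf3))).congr' ?_ .rfl
    filter_upwards [hf2.eventually hφ, hf3.eventually hφ] with q h2 h3
    simp only [Function.comp_apply]
    rw [φ.left_inv h2, φ.left_inv h3]
  have hAc : Tendsto (fun q : N × N × N ↦ A q.1) (𝓝 (y₀, y₀, y₀)) (𝓝 (A y₀)) :=
    ((continuousOn_tangentCoordChange (I := I) p y₀).continuousAt
      (inter_mem (extChartAt_source_mem_nhds' hp) hφ)).tendsto.comp hf1
  have hAT (v : E) : A y₀ (T v) = v := by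
    rw [hA, hT, tangentCoordChange_comp ⟨⟨hy₀, hp⟩, hy₀⟩, tangentCoordChange_self hy₀]
  -- `A y (ψ z - ψ z') - (φ z - φ z')` is the sum of `A y (ψ z - ψ z' - T (φ z - φ z'))`
  -- and `(A y - A y₀) (T (φ z - φ z'))`, because `A y₀` is inverse to `T`
  have h1 : (fun q : N × N × N ↦ A q.1 (ψ q.2.1 - ψ q.2.2 - T (φ q.2.1 - φ q.2.2)))
      =o[𝓝 (y₀, y₀, y₀)] fun q ↦ φ q.2.1 - φ q.2.2 := by
    exact isLittleO_clm_apply_of_isBigO (hAc.isBigO_one ℝ) hl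
  have h2 : (fun q : N × N × N ↦ (A q.1 - A y₀) (T (φ q.2.1 - φ q.2.2)))
      =o[𝓝 (y₀, y₀, y₀)] fun q ↦ φ q.2.1 - φ q.2.2 := by
    have hO : (fun q : N × N × N ↦ A q.1 - A y₀) =o[𝓝 (y₀, y₀, y₀)] fun _ ↦ (1 : ℝ) := by
      rw [isLittleO_one_iff]
      simpa using hAc.sub_const (A y₀)
    exact isLittleO_clm_apply_of_isLittleO hO (T.isBigO_comp _ _)
  refine (h1.add h2).congr_left fun q ↦ ?_
  simp only [map_sub, sub_apply, hAT]
  abel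

/-- The main estimate: in the chart at `f x₀`, the map `z ↦ chartDiff I f p ρ x z` differs from the
chart itself by a map with arbitrarily small Lipschitz constant, for `x` near `x₀` and `z` near
`f x₀`. -/
theorem chartDiff_sub_chartDiff_isLittleO [I.Boundaryless] (hf : Continuous f)
    (hρ : ∀ i, Continuous (ρ i)) (hsum : ∀ x, ∑ i, ρ i x = 1)
    (hsub : ∀ i, tsupport (ρ i) ⊆ f ⁻¹' (chartAt H (p i)).source) (x : X) :
    (fun q : X × N × N ↦
      (trivializationAt E (TangentSpace I) (f x)).continuousLinearMapAt ℝ (f q.1)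
          (chartDiff I f p ρ q.1 q.2.1 - chartDiff I f p ρ q.1 q.2.2) -
        (extChartAt I (f x) q.2.1 - extChartAt I (f x) q.2.2)) =o[𝓝 (x, f x, f x)]
    fun q ↦ extChartAt I (f x) q.2.1 - extChartAt I (f x) q.2.2 := by
  have hf1 : Tendsto (fun q : X × N × N ↦ f q.1) (𝓝 (x, f x, f x)) (𝓝 (f x)) :=
    (hf.comp continuous_fst).continuousAt
  have hf23 : Tendsto (fun q : X × N × N ↦ q.2) (𝓝 (x, f x, f x)) (𝓝 (f x, f x)) :=
    continuous_snd.continuousAt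
  have hs0 := (chartAt H (f x)).open_source.mem_nhds (mem_chart_source H (f x))
  have key (i : ι) : (fun q : X × N × N ↦ ρ i q.1 •
      ((trivializationAt E (TangentSpace I) (f x)).continuousLinearMapAt ℝ (f q.1)
        ((trivializationAt E (TangentSpace I) (p i)).symmL ℝ (f q.1)
          (extChartAt I (p i) q.2.1 - extChartAt I (p i) q.2.2)) -
        (extChartAt I (f x) q.2.1 - extChartAt I (f x) q.2.2)))
      =o[𝓝 (x, f x, f x)] fun q ↦ extChartAt I (f x) q.2.1 - extChartAt I (f x) q.2.2 := by
    by_cases hx : x ∈ tsupport (ρ i)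
    · have hpi : f x ∈ (chartAt H (p i)).source := hsub i hx
      have hl := (tangentCoordChange_sub_isLittleO I (p := p i) (y₀ := f x)
        (by rwa [extChartAt_source])).comp_tendsto (hf1.prodMk_nhds hf23)
      have hb : (fun q : X × N × N ↦ ρ i q.1) =O[𝓝 (x, f x, f x)] fun _ ↦ (1 : ℝ) :=
        (((hρ i).comp continuous_fst).continuousAt (x := (x, f x, f x))).tendsto.isBigO_one ℝ
      have hbl := hb.smul_isLittleO hl
      simp only [one_smul] at hbl
      refine hbl.congr' ?_ .rfl
      filter_upwards [hf1.eventually hs0,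
        hf1.eventually ((chartAt H (p i)).open_source.mem_nhds hpi)] with q hq0 hqi
      rw [continuousLinearMapAt_symmL_eq I hqi hq0]
      rfl
    · refine (isLittleO_zero _ _).congr' ?_ .rfl
      have h0 : ∀ᶠ q : X × N × N in 𝓝 (x, f x, f x), q.1 ∉ tsupport (ρ i) :=
        ((isClosed_tsupport (ρ i)).isOpen_compl.preimage continuous_fst).mem_nhds hx
      filter_upwards [h0] with q hq
      rw [image_eq_zero_of_notMem_tsupport hq, zero_smul]
  refine (IsLittleO.sum (s := Finset.univ) fun i _ ↦ key i).congr_left fun q ↦ ?_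
  rw [Finset.sum_apply]
  set e := trivializationAt E (TangentSpace I) (f x)
  have hdiff : chartDiff I f p ρ q.1 q.2.1 - chartDiff I f p ρ q.1 q.2.2 =
      ∑ i, ρ i q.1 • (trivializationAt E (TangentSpace I) (p i)).symmL ℝ (f q.1)
        (extChartAt I (p i) q.2.1 - extChartAt I (p i) q.2.2) := by
    rw [chartDiff, chartDiff, ← Finset.sum_sub_distrib]
    refine Finset.sum_congr rfl fun i _ ↦ ?_
    rw [← map_sub, ← smul_sub, sub_sub_sub_cancel_right, map_smul]
  rw [hdiff, map_sum]
  simp_rw [smul_sub (ρ _ _), Finset.sum_sub_distrib, ← Finset.sum_smul, hsum, one_smul, map_smul]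

theorem eventually_eq_of_chartDiff_eq [I.Boundaryless] (hf : Continuous f)
    (hρ : ∀ i, Continuous (ρ i)) (hsum : ∀ x, ∑ i, ρ i x = 1)
    (hsub : ∀ i, tsupport (ρ i) ⊆ f ⁻¹' (chartAt H (p i)).source) (x : X) :
    ∀ᶠ q : X × N × N in 𝓝 (x, f x, f x),
      chartDiff I f p ρ q.1 q.2.1 = chartDiff I f p ρ q.1 q.2.2 → q.2.1 = q.2.2 := by
  have hs0 := extChartAt_source_mem_nhds (I := I) (f x)
  have hf2 : ContinuousAt (fun q : X × N × N ↦ q.2.1) (x, f x, f x) := by fun_prop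
  have hf3 : ContinuousAt (fun q : X × N × N ↦ q.2.2) (x, f x, f x) := by fun_prop
  filter_upwards [hf2.eventually hs0, hf3.eventually hs0,
    (chartDiff_sub_chartDiff_isLittleO I hf hρ hsum hsub x).def one_half_pos]
    with q h2 h3 hq heq
  refine (extChartAt I (f x)).injOn h2 h3 (sub_eq_zero.1 (norm_le_zero_iff.1 ?_))
  rw [heq, sub_self, map_zero, zero_sub, norm_neg] at hq
  linarith

theorem eventually_exists_chartDiff_eq [CompleteSpace E] [I.Boundaryless] (hf : Continuous f)
    (hρ : ∀ i, Continuous (ρ i)) (hsum : ∀ x, ∑ i, ρ i x = 1)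
    (hsub : ∀ i, tsupport (ρ i) ⊆ f ⁻¹' (chartAt H (p i)).source) (x : X)
    {O : Set (X × N)} (hO : O ∈ 𝓝 (x, f x)) :
    ∀ᶠ q : X × TangentBundle I N in 𝓝 (x, ⟨f x, 0⟩), q.2.proj = f q.1 →
      ∃ z, (q.1, z) ∈ O ∧ (⟨f q.1, chartDiff I f p ρ q.1 z⟩ : TangentBundle I N) = q.2 := by
  set φ := extChartAt I (f x) with hφ
  set e := trivializationAt E (TangentSpace I) (f x)
  have hsymm : ContinuousAt φ.symm (φ (f x)) := continuousAt_extChartAt_symm (f x)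
  have hφφ : φ.symm (φ (f x)) = f x := φ.left_inv (mem_extChartAt_source (f x))
  have hest : ∀ᶠ q : X × E × E in 𝓝 x ×ˢ 𝓝 (φ (f x), φ (f x)),
      ‖e.continuousLinearMapAt ℝ (f q.1) (chartDiff I f p ρ q.1 (φ.symm q.2.1) -
          chartDiff I f p ρ q.1 (φ.symm q.2.2)) - (q.2.1 - q.2.2)‖ ≤ 1 / 2 * ‖q.2.1 - q.2.2‖ ∧
        (q.1, φ.symm q.2.1) ∈ O := by
    rw [← nhds_prod_eq]
    have ht1 : Tendsto (fun q : X × E × E ↦ φ.symm q.2.1) (𝓝 (x, φ (f x), φ (f x)))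
        (𝓝 (f x)) := by
      have : ContinuousAt (fun q : X × E × E ↦ q.2.1) (x, φ (f x), φ (f x)) := by fun_prop
      have h := hsymm.tendsto.comp this.tendsto
      rwa [hφφ] at h
    have ht2 : Tendsto (fun q : X × E × E ↦ φ.symm q.2.2) (𝓝 (x, φ (f x), φ (f x)))
        (𝓝 (f x)) := by
      have : ContinuousAt (fun q : X × E × E ↦ q.2.2) (x, φ (f x), φ (f x)) := by fun_prop
      have h := hsymm.tendsto.comp this.tendsto
      rwa [hφφ] at h
    have ht0 : Tendsto (fun q : X × E × E ↦ q.1) (𝓝 (x, φ (f x), φ (f x))) (𝓝 x) :=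
      continuous_fst.continuousAt
    have hm1 : ∀ᶠ q : X × E × E in 𝓝 (x, φ (f x), φ (f x)), q.2.1 ∈ φ.target :=
      ContinuousAt.preimage_mem_nhds (f := fun q : X × E × E ↦ q.2.1) (by fun_prop)
        (extChartAt_target_mem_nhds (f x))
    have hm2 : ∀ᶠ q : X × E × E in 𝓝 (x, φ (f x), φ (f x)), q.2.2 ∈ φ.target :=
      ContinuousAt.preimage_mem_nhds (f := fun q : X × E × E ↦ q.2.2) (by fun_prop)
        (extChartAt_target_mem_nhds (f x))
    have h := (ht0.prodMk_nhds (ht1.prodMk_nhds ht2)).eventually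
      ((chartDiff_sub_chartDiff_isLittleO I hf hρ hsum hsub x).def one_half_pos)
    filter_upwards [h, hm1, hm2, (ht0.prodMk_nhds ht1).eventually hO] with q hq h1 h2 h3
    refine ⟨?_, h3⟩
    simpa only [← hφ, φ.right_inv h1, φ.right_inv h2] using hq
  -- a neighbourhood of `x` and a ball of radius `r` on which the estimate holds; the fixed-point
  -- argument is applied around `φ (f y)` for `y` near `x`, where the map vanishes exactly
  obtain ⟨P, hP, Q, hQ, hPQ⟩ := eventually_prod_iff.1 hest
  obtain ⟨r, hr, hrQ⟩ := Metric.nhds_basis_closedBall.eventually_iff.1 hQ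
  have hball {y z : E} (hy : y ∈ Metric.closedBall (φ (f x)) r)
      (hz : z ∈ Metric.closedBall (φ (f x)) r) : Q (y, z) := by
    refine hrQ ?_
    rw [← closedBall_prod_same]
    exact ⟨hy, hz⟩
  have hfq : ContinuousAt (fun q : X × TangentBundle I N ↦ f q.1)
      (x, (⟨f x, 0⟩ : TangentBundle I N)) := (hf.comp continuous_fst).continuousAt
  have hφq : ∀ᶠ q : X × TangentBundle I N in 𝓝 (x, ⟨f x, 0⟩),
      φ (f q.1) ∈ Metric.closedBall (φ (f x)) (r / 2) :=
    (ContinuousAt.comp (f := fun q : X × TangentBundle I N ↦ f q.1)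
      (continuousAt_extChartAt (f x)) hfq).eventually (Metric.closedBall_mem_nhds _ (half_pos hr))
  have hvq : ∀ᶠ q : X × TangentBundle I N in 𝓝 (x, ⟨f x, 0⟩),
      (e q.2).2 ∈ Metric.closedBall (0 : E) (r / 4) := by
    have h0 : (e (⟨f x, 0⟩ : TangentBundle I N)).2 = 0 := by
      rw [← e.continuousLinearMapAt_apply_of_mem (R := ℝ) (mem_chart_source H (f x)), map_zero]
    have he0 : Tendsto (fun v : TangentBundle I N ↦ (e v).2) (𝓝 ⟨f x, 0⟩)
        (𝓝 (e (⟨f x, 0⟩ : TangentBundle I N)).2) :=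
      (e.continuousAt (FiberBundle.mem_trivializationAt_proj_source
        (x := (⟨f x, 0⟩ : TangentBundle I N)))).snd
    have hc := he0.comp (continuous_snd.continuousAt (x := (x, (⟨f x, 0⟩ : TangentBundle I N))))
    refine hc.eventually ?_
    rw [h0]
    exact Metric.closedBall_mem_nhds _ (by positivity)
  have hsq : ∀ᶠ q : X × TangentBundle I N in 𝓝 (x, ⟨f x, 0⟩), f q.1 ∈ (chartAt H (f x)).source :=
    hfq.eventually ((chartAt H (f x)).open_source.mem_nhds (mem_chart_source H (f x)))
  filter_upwards [continuous_fst.continuousAt.eventually hP, hφq, hvq, hsq]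
    with ⟨y, ⟨y', v⟩⟩ hPy hφy hv hsy hyy'
  obtain rfl : y' = f y := hyy'
  simp only at hPy hφy hv hsy
  set h : E → E := fun u ↦ e.continuousLinearMapAt ℝ (f y) (chartDiff I f p ρ y (φ.symm u)) with hh
  obtain ⟨u, hu, huv⟩ := exists_eq_of_norm_sub_sub_le (h := h) hr
    (fun u hu u' hu' ↦ by simpa only [hh, map_sub] using (hPQ hPy (hball hu hu')).1) hφy (by
      simp only [hh]
      rw [φ.left_inv (by rwa [hφ, extChartAt_source])]
      simp [chartDiff]) hv
  refine ⟨φ.symm u, (hPQ hPy (hball hu hu)).2, ?_⟩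
  rw [← e.continuousLinearMapAt_apply_of_mem (R := ℝ) hsy] at huv
  have := congrArg (e.symmL ℝ (f y)) huv
  rw [hh, e.symmL_continuousLinearMapAt hsy, e.symmL_continuousLinearMapAt hsy] at this
  rw [this]

/-- A substitute for the inverses of the exponential maps at the points `f x`. -/
theorem exists_isFibrewiseCoord_tangentSpace [CompleteSpace E] [I.Boundaryless] [T2Space X]
    [CompactSpace X] {f : X → N} (hf : Continuous f) :
    ∃ Ψ : ∀ x, N → TangentSpace I (f x),
      IsFibrewiseCoord E (V := (TangentSpace I : N → Type _)) f Ψ := by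
  obtain ⟨t, ht⟩ := isCompact_univ.elim_finite_subcover
    (fun x : X ↦ f ⁻¹' (chartAt H (f x)).source)
    (fun x ↦ (chartAt H (f x)).open_source.preimage hf)
    (fun x _ ↦ mem_iUnion.2 ⟨x, mem_chart_source H (f x)⟩)
  obtain ⟨ρ, hρ⟩ := PartitionOfUnity.exists_isSubordinate isClosed_univ
    (fun x : t ↦ f ⁻¹' (chartAt H (f x)).source)
    (fun x ↦ (chartAt H (f x)).open_source.preimage hf)
    (fun x hx ↦ by simpa using ht hx)
  have hc (i : t) : Continuous (ρ i) := (ρ i).continuous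
  have hsum (x : X) : ∑ i, ρ i x = 1 := by
    rw [← finsum_eq_sum_of_fintype]
    exact ρ.sum_eq_one (mem_univ x)
  exact ⟨chartDiff I f (fun x : t ↦ f x) fun i ↦ ρ i,
    { eventually_continuousAt := continuousAt_chartDiff I hf hc hρ
      eventually_injective := eventually_eq_of_chartDiff_eq I hf hc hsum hρ
      eventually_exists_eq := fun x _ hO ↦
        eventually_exists_chartDiff_eq I hf hc hsum hρ x hO }⟩

end Manifold

/-! ### Sections of the quotient bundle -/

section TensorW

/-- The orthogonal projection of the `i`-th basis vector of `ℝ ^ k` to `W_k`. -/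
noncomputable def centeredBasis (k : ℕ) (i : Fin k) : W k :=
  ⟨fun j ↦ (if j = i then 1 else 0) - 1 / k, by
    have : (k : ℝ) ≠ 0 := Nat.cast_ne_zero.2 i.pos.ne'
    change ∑ j, _ = (0 : ℝ)
    simp [Finset.sum_sub_distrib, this]⟩

theorem permW_centeredBasis (k : ℕ) (σ : Equiv.Perm (Fin k)) (i : Fin k) :
    permW k σ (centeredBasis k i) = centeredBasis k (σ i) := by
  refine Subtype.ext (funext fun j ↦ ?_)
  change (if σ⁻¹ j = i then (1 : ℝ) else 0) - 1 / k = (if j = σ i then 1 else 0) - 1 / k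
  simp only [Equiv.Perm.inv_eq_iff_eq]

/-- The element of `V ⊗ W_k` with coordinates `v j - (∑ i, v i) / k`, for a family `v` of `k`
vectors: the image of `v ∈ V ⊗ ℝ ^ k` under the orthogonal projection `ℝ ^ k → W_k`. -/
noncomputable def centered {k : ℕ} {V : Type*} [AddCommMonoid V] [Module ℝ V] (v : Fin k → V) :
    V ⊗[ℝ] W k :=
  ∑ i, v i ⊗ₜ centeredBasis k i

variable {k : ℕ}

theorem lTensor_permW_centered {V : Type*} [AddCommMonoid V] [Module ℝ V]
    (σ : Equiv.Perm (Fin k)) (v : Fin k → V) :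
    (permW k σ).lTensor V (centered v) = centered fun i ↦ v (σ⁻¹ i) := by
  simp only [centered, map_sum, LinearMap.lTensor_tmul, permW_centeredBasis]
  exact Fintype.sum_equiv σ _ _ fun i ↦ by simp

variable {X : Type*} {V : X → Type*} [∀ x, AddCommMonoid (V x)] [∀ x, Module ℝ (V x)]

theorem tensorCoord_centered (x : X) (v : Fin k → V x) (j : Fin k) :
    tensorCoord k V x j (centered v) = ∑ i, (centeredBasis k i).1 j • v i := by
  simp [tensorCoord, centered, coordW]

theorem eq_of_centered_eq_zero (x : X) {v : Fin k → V x}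
    (hv : (centered v : TensorW k V x) = 0) (i j : Fin k) : v i = v j := by
  let := Module.addCommMonoidToAddCommGroup ℝ (M := V x)
  have h (j : Fin k) : v j = (1 / k : ℝ) • ∑ i, v i := by
    have := (tensorCoord_centered x v j).symm.trans (by rw [hv, map_zero])
    simpa [centeredBasis, sub_smul, Finset.sum_sub_distrib, Finset.smul_sum, sub_eq_zero]
      using this
  rw [h i, ← h j]

end TensorW

theorem continuous_conf_apply {Y : Type*} [TopologicalSpace Y] {k : ℕ} (i : Fin k) :
    Continuous fun c : Conf Y k ↦ c.1 i :=
  (continuous_apply i).comp continuous_subtype_val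

instance {Y : Type*} [TopologicalSpace Y] {k : ℕ} :
    ContinuousConstSMul (Equiv.Perm (Fin k)) (Conf Y k) where
  continuous_const_smul σ :=
    Continuous.subtype_mk (continuous_pi fun i ↦ continuous_conf_apply (σ⁻¹ i)) _

/-- An equivariant family of `k`-tuples of vectors that are never all equal gives a nowhere zero
section of the quotient bundle. -/
theorem hasNowhereZeroSection_of_equivariant {k : ℕ} {X Y : Type*} [TopologicalSpace X]
    [TopologicalSpace Y] {F : Type*} [NormedAddCommGroup F] [NormedSpace ℝ F] {V : X → Type*}
    [∀ x, AddCommMonoid (V x)] [∀ x, Module ℝ (V x)] [∀ x, TopologicalSpace (V x)]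
    [TopologicalSpace (TotalSpace F V)] [FiberBundle F V] [VectorBundle ℝ F V]
    (w : ∀ x, Conf Y k → Fin k → V x)
    (hw : ∀ i, Continuous fun q : X × Conf Y k ↦ (⟨q.1, w q.1 q.2 i⟩ : TotalSpace F V))
    (hσ : ∀ (σ : Equiv.Perm (Fin k)) x c i, w x (σ • c) i = w x c (σ⁻¹ i))
    (hne : ∀ x c, ∃ i j, w x c i ≠ w x c j) :
    HasNowhereZeroSection k V F Y := by
  let s₀ : X × Conf Y k → PullbackTotal k V F Y := fun q ↦
    ⟨q, (centered (w q.1 q.2) : TensorW k V q.1)⟩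
  have hs₀ : Continuous s₀ := by
    rw [(inducing_pullbackTotalSpaceEmbedding _ _ _).continuous_iff]
    refine continuous_id.prodMk (continuous_induced_rng.2 (continuous_fst.prodMk
      (continuous_pi fun j ↦ continuous_iff_continuousAt.2 fun q ↦ ?_)))
    refine (continuousAt_totalSpace_sum (F := F) (V := V) Finset.univ
      (fun i ↦ (centeredBasis k i).1 j) continuous_fst.continuousAt
      fun i _ ↦ (hw i).continuousAt).congr (Eventually.of_forall fun q ↦ ?_)
    exact congrArg (TotalSpace.mk _) (tensorCoord_centered q.1 _ j).symm
  have hsmul (σ : Equiv.Perm (Fin k)) (x : X) (c : Conf Y k) : s₀ (x, σ • c) = σ • s₀ (x, c) := by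
    refine PullbackTotal.mk_eq rfl ?_
    refine Eq.trans ?_ (lTensor_permW_centered σ (w x c)).symm
    exact congrArg centered (funext fun i ↦ hσ σ x c i)
  let s : X × UConf Y k → QuotientTotal k V F Y := fun b ↦
    Quotient.lift (fun c ↦ (Quotient.mk _ (s₀ (b.1, c)) : QuotientTotal k V F Y)) (by
      rintro c c' ⟨σ, rfl⟩
      exact Quotient.sound ⟨σ, (hsmul σ b.1 c').symm⟩) b.2
  refine ⟨s, ?_, ?_, ?_⟩
  · have hq : IsOpenQuotientMap (Prod.map id (Quotient.mk _) : X × Conf Y k → X × UConf Y k) :=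
      .prodMap .id MulAction.isOpenQuotientMap_quotientMk
    rw [← hq.continuous_comp_iff]
    exact continuous_quotient_mk'.comp hs₀
  · rintro ⟨x, c⟩
    induction c using Quotient.inductionOn with
    | h c => rfl
  · rintro ⟨x, c⟩ x' c' h
    induction c using Quotient.inductionOn with
    | h c =>
      obtain ⟨σ, hσ'⟩ := Quotient.exact h
      have hz : s₀ (x, c) = ⟨(x', σ • c'), (0 : TensorW k V x')⟩ := by
        refine hσ'.symm.trans (PullbackTotal.mk_eq rfl ?_)
        exact map_zero ((permW k σ).lTensor (V x'))
      obtain ⟨i, j, hij⟩ := hne x c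
      refine hij (eq_of_centered_eq_zero x ?_ i j)
      have h1 := congrArg TotalSpace.proj hz
      obtain ⟨rfl, -⟩ := Prod.ext_iff.1 h1
      obtain rfl : c = σ • c' := (Prod.ext_iff.1 h1).2
      exact TotalSpace.mk_injective (E := (Prod.fst : X × Conf Y k → X) *ᵖ (TensorW k V)) _ hz

/-- The inverse of a trivialization of `ξ ⊕ ζ`, as a continuous family of linear maps. -/
theorem IsInverseBundle.exists_linearMap {L : ℕ} {X : Type*} [TopologicalSpace X]
    {F₁ : Type*} [NormedAddCommGroup F₁] [NormedSpace ℝ F₁] {ξ : X → Type*}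
    [∀ x, AddCommGroup (ξ x)] [∀ x, Module ℝ (ξ x)] [TopologicalSpace (TotalSpace F₁ ξ)]
    {F₂ : Type*} [NormedAddCommGroup F₂] [NormedSpace ℝ F₂] {ζ : X → Type*}
    [∀ x, AddCommGroup (ζ x)] [∀ x, Module ℝ (ζ x)] [TopologicalSpace (TotalSpace F₂ ζ)]
    (h : IsInverseBundle L F₁ ξ F₂ ζ) :
    ∃ G : ∀ x, EuclideanSpace ℝ (Fin L) →ₗ[ℝ] ξ x × ζ x, (∀ x, Function.Injective (G x)) ∧
      Continuous (fun q : X × EuclideanSpace ℝ (Fin L) ↦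
        (⟨q.1, (G q.1 q.2).1⟩ : TotalSpace F₁ ξ)) ∧
      Continuous (fun q : X × EuclideanSpace ℝ (Fin L) ↦
        (⟨q.1, (G q.1 q.2).2⟩ : TotalSpace F₂ ζ)) := by
  obtain ⟨Θ, hΘ, hlin⟩ := h
  let T (x : X) : (ξ x × ζ x) →ₗ[ℝ] EuclideanSpace ℝ (Fin L) := (hlin x).mk'
  have hT (x : X) (v : ξ x × ζ x) : Θ ⟨x, v⟩ = (x, T x v) := Prod.ext (hΘ _) rfl
  have hinj (x : X) : Function.Injective (T x) := fun v v' hv ↦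
    TotalSpace.mk_injective (E := ξ ×ᵇ ζ) x
      (Θ.injective (((hT x v).trans (by rw [hv])).trans (hT x v').symm))
  have hsurj (x : X) : Function.Surjective (T x) := fun u ↦ by
    obtain ⟨⟨x', v⟩, hv⟩ := Θ.surjective (x, u)
    rw [hT] at hv
    obtain ⟨rfl, rfl⟩ := Prod.ext_iff.1 hv
    exact ⟨v, rfl⟩
  let e (x : X) := LinearEquiv.ofBijective (T x) ⟨hinj x, hsurj x⟩
  have he (q : X × EuclideanSpace ℝ (Fin L)) :
      Θ.symm q = (⟨q.1, (e q.1).symm q.2⟩ : TotalSpace (F₁ × F₂) (ξ ×ᵇ ζ)) := by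
    rw [Homeomorph.symm_apply_eq, hT]
    exact Prod.ext rfl ((e q.1).apply_symm_apply q.2).symm
  have hc := (FiberBundle.Prod.isInducing_diag F₁ ξ F₂ ζ).continuous.comp Θ.symm.continuous
  refine ⟨fun x ↦ (e x).symm.toLinearMap, fun x ↦ (e x).symm.injective, ?_, ?_⟩
  · exact (continuous_fst.comp hc).congr fun q ↦ congrArg
      (fun p : TotalSpace (F₁ × F₂) (ξ ×ᵇ ζ) ↦ (⟨p.1, p.2.1⟩ : TotalSpace F₁ ξ)) (he q)
  · exact (continuous_snd.comp hc).congr fun q ↦ congrArg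
      (fun p : TotalSpace (F₁ × F₂) (ξ ×ᵇ ζ) ↦ (⟨p.1, p.2.2⟩ : TotalSpace F₂ ζ)) (he q)

/-! ### Uniformity over a compact base -/

section Compact

variable {M : Type*} [EMetricSpace M] [CompactSpace M]

theorem exists_edist_le_of_eventually {P : M → M → M → Prop}
    (hP : ∀ x, ∀ᶠ q : M × M × M in 𝓝 (x, x, x), P q.1 q.2.1 q.2.2) {r : ℝ≥0∞} (hr : 0 < r) :
    ∃ δ, 0 < δ ∧ δ < r ∧ ∀ x z z', edist x z ≤ δ → edist x z' ≤ δ → P x z z' := by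
  have key : ∀ᶠ δ : ℝ≥0∞ in 𝓝 0, ∀ x ∈ (univ : Set M),
      ∀ z z', edist x z ≤ δ → edist x z' ≤ δ → P x z z' := by
    refine isCompact_univ.eventually_forall_of_forall_eventually fun x _ ↦ ?_
    obtain ⟨ε, hε, h⟩ := Metric.nhds_basis_eball.eventually_iff.1 (hP x)
    have h1 : ∀ᶠ q : ℝ≥0∞ × M in 𝓝 (0, x), q.1 < ε / 2 :=
      continuous_fst.continuousAt.preimage_mem_nhds (Iio_mem_nhds (ENNReal.half_pos hε.ne'))
    have h2 : ∀ᶠ q : ℝ≥0∞ × M in 𝓝 (0, x), q.2 ∈ Metric.eball x (ε / 2) :=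
      continuous_snd.continuousAt.preimage_mem_nhds
        (Metric.eball_mem_nhds x (ENNReal.half_pos hε.ne'))
    filter_upwards [h1, h2] with q hq1 hq2 z z' hz hz'
    have hb {y : M} (hy : edist q.2 y ≤ q.1) : edist y x < ε := by
      calc edist y x ≤ edist y q.2 + edist q.2 x := edist_triangle _ _ _
        _ < ε / 2 + ε / 2 := ENNReal.add_lt_add (by rw [edist_comm]; exact hy.trans_lt hq1) hq2
        _ = ε := ENNReal.add_halves ε
    refine h (x := (q.2, z, z')) ?_
    rw [Metric.mem_eball, Prod.edist_eq, Prod.edist_eq]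
    exact max_lt (hb (by simp)) (max_lt (hb hz) (hb hz'))
  obtain ⟨δ, ⟨hδ, hδr⟩, hδ0⟩ := ((key.and (Iio_mem_nhds hr)).filter_mono
    (nhdsWithin_le_nhds (s := Ioi 0))).and self_mem_nhdsWithin |>.exists
  exact ⟨δ, hδ0, hδr, fun x ↦ hδ x trivial⟩

variable {F : Type*} [NormedAddCommGroup F] [NormedSpace ℝ F] {ξ : M → Type*}
  [∀ x, AddCommGroup (ξ x)] [∀ x, Module ℝ (ξ x)] [∀ x, TopologicalSpace (ξ x)]
  [TopologicalSpace (TotalSpace F ξ)] [FiberBundle F ξ]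

/-- Fibrewise coordinates centred at the points of a compact `M` have, on a uniform neighbourhood of
the zero vectors, a continuous inverse `Z`. The vectors are parametrized by linear maps `ℓ x`, which
need not be injective. -/
theorem exists_continuousOn_inverse {Ψ : ∀ x, M → ξ x} (hΨ : IsFibrewiseCoord F (fun x ↦ x) Ψ)
    {δ : ℝ≥0∞} (hδ : 0 < δ)
    (hcont : ∀ x z, edist x z ≤ δ →
      ContinuousAt (fun q : M × M ↦ (⟨q.1, Ψ q.1 q.2⟩ : TotalSpace F ξ)) (x, z))
    (hinj : ∀ x z z', edist x z ≤ δ → edist x z' ≤ δ → Ψ x z = Ψ x z' → z = z')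
    {R : Type*} [NormedAddCommGroup R] [NormedSpace ℝ R] (ℓ : ∀ x, R →ₗ[ℝ] ξ x)
    (hℓ : Continuous fun q : M × R ↦ (⟨q.1, ℓ q.1 q.2⟩ : TotalSpace F ξ)) :
    ∃ ε > 0, ∃ Z : M × R → M, ContinuousOn Z {q | ‖q.2‖ < ε} ∧
      ∀ x u, ‖u‖ < ε → edist x (Z (x, u)) ≤ δ ∧ Ψ x (Z (x, u)) = ℓ x u := by
  have hT2 : T2Space (TotalSpace F ξ) := t2Space_totalSpace
  have key : ∀ᶠ u : R in 𝓝 0, ∀ x ∈ (univ : Set M), ∃ z, edist x z ≤ δ ∧ Ψ x z = ℓ x u := by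
    refine isCompact_univ.eventually_forall_of_forall_eventually fun x _ ↦ ?_
    have hO : {q : M × M | edist q.1 q.2 ≤ δ} ∈ 𝓝 (x, x) := by
      have : {q : M × M | edist q.1 q.2 < δ} ∈ 𝓝 (x, x) :=
        (isOpen_lt continuous_edist continuous_const).mem_nhds (by simpa using hδ)
      exact mem_of_superset this fun q (hq : edist q.1 q.2 < δ) ↦ hq.le
    have hc : Tendsto (fun q : R × M ↦ (q.2, (⟨q.2, ℓ q.2 q.1⟩ : TotalSpace F ξ))) (𝓝 (0, x))
        (𝓝 (x, ⟨x, 0⟩)) := by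
      have : Continuous fun q : R × M ↦ (q.2, (⟨q.2, ℓ q.2 q.1⟩ : TotalSpace F ξ)) :=
        continuous_snd.prodMk (hℓ.comp continuous_swap)
      convert this.tendsto (0, x)
      simp
    filter_upwards [hc.eventually (hΨ.eventually_exists_eq x _ hO)] with q hq
    obtain ⟨z, hz, hzq⟩ := hq rfl
    exact ⟨z, hz, TotalSpace.mk_inj.1 hzq⟩
  obtain ⟨ε, hε, hball⟩ := Metric.eventually_nhds_iff_ball.1 key
  have hex (q : {q : M × R // ‖q.2‖ < ε}) :
      ∃ z, edist q.1.1 z ≤ δ ∧ Ψ q.1.1 z = ℓ q.1.1 q.1.2 :=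
    hball q.1.2 (by simpa using q.2) q.1.1 trivial
  choose Z hZ using hex
  let D := {q : M × M // edist q.1 q.2 ≤ δ}
  have hD : CompactSpace D := isCompact_iff_compactSpace.1
    (isClosed_le continuous_edist continuous_const).isCompact
  -- `j` is an embedding because `D` is compact, so `Z` is continuous as soon as
  -- `ℓ = j ∘ (id, Z)` is
  let j : D → TotalSpace F ξ := fun q ↦ ⟨q.1.1, Ψ q.1.1 q.1.2⟩
  have hj : IsClosedEmbedding j := by
    refine Continuous.isClosedEmbedding ?_ ?_
    · refine continuous_iff_continuousAt.2 fun q ↦ ?_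
      exact ContinuousAt.comp (f := Subtype.val) (hcont _ _ q.2) continuous_subtype_val.continuousAt
    · rintro ⟨⟨x, z⟩, hz⟩ ⟨⟨x', z'⟩, hz'⟩ h
      obtain rfl : x = x' := congrArg TotalSpace.proj h
      obtain rfl : z = z' := hinj x z z' hz hz' (TotalSpace.mk_inj.1 h)
      rfl
  have hZc : Continuous Z := by
    let g : {q : M × R // ‖q.2‖ < ε} → D := fun q ↦ ⟨(q.1.1, Z q), (hZ q).1⟩
    have hg : Continuous g := by
      rw [hj.isEmbedding.continuous_iff]
      refine (hℓ.comp continuous_subtype_val).congr fun q ↦ ?_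
      exact congrArg (TotalSpace.mk _) (hZ q).2.symm
    exact continuous_snd.comp (continuous_subtype_val.comp hg)
  classical
  refine ⟨ε, hε, fun q ↦ if h : ‖q.2‖ < ε then Z ⟨q, h⟩ else q.1, ?_, fun x u hu ↦ ?_⟩
  · rw [continuousOn_iff_continuous_domRestrict]
    refine hZc.congr fun q ↦ ?_
    change Z q = if h : ‖q.1.2‖ < ε then Z ⟨q.1, h⟩ else q.1.1
    rw [dif_pos q.2]
  · simpa [hu] using hZ ⟨(x, u), hu⟩

end Compact

/-! ### Local multiplicities -/

/-- The theorem for arbitrary bundles `ξ` and `η` in place of the tangent bundles of `M` and `N`,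
with fibrewise coordinates in place of the inverses of the exponential maps. -/
theorem admitsLocalMultiplicity_of_isFibrewiseCoord {k L : ℕ} {M N : Type*} [EMetricSpace M]
    [CompactSpace M] [TopologicalSpace N] (f : C(M, N))
    {F₁ : Type*} [NormedAddCommGroup F₁] [NormedSpace ℝ F₁] {ξ : M → Type*}
    [∀ x, AddCommGroup (ξ x)] [∀ x, Module ℝ (ξ x)] [∀ x, TopologicalSpace (ξ x)]
    [TopologicalSpace (TotalSpace F₁ ξ)] [FiberBundle F₁ ξ]
    {F₂ : Type*} [NormedAddCommGroup F₂] [NormedSpace ℝ F₂] {ζ : M → Type*}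
    [∀ x, AddCommGroup (ζ x)] [∀ x, Module ℝ (ζ x)] [∀ x, TopologicalSpace (ζ x)]
    [TopologicalSpace (TotalSpace F₂ ζ)] [FiberBundle F₂ ζ] [VectorBundle ℝ F₂ ζ]
    {F₃ : Type*} [NormedAddCommGroup F₃] [NormedSpace ℝ F₃] {η : N → Type*}
    [∀ x, AddCommGroup (η x)] [∀ x, Module ℝ (η x)] [∀ x, TopologicalSpace (η x)]
    [TopologicalSpace (TotalSpace F₃ η)] [FiberBundle F₃ η] [VectorBundle ℝ F₃ η]
    {Ψ : ∀ x, M → ξ x} (hΨ : IsFibrewiseCoord F₁ (fun x ↦ x) Ψ)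
    {Φ : ∀ x, N → η (f x)} (hΦ : IsFibrewiseCoord F₃ f Φ)
    (hζ : IsInverseBundle L F₁ ξ F₂ ζ)
    (hs : ¬ HasNowhereZeroSection k (((f : M → N) *ᵖ η) ×ᵇ ζ) (F₃ × F₂)
      (EuclideanSpace ℝ (Fin L))) :
    AdmitsLocalMultiplicity k f := by
  intro r hr
  by_contra! hno
  refine hs ?_
  obtain ⟨G, hGinj, hG₁, hG₂⟩ := hζ.exists_linearMap
  have hev (x : M) : ∀ᶠ q : M × M × M in 𝓝 (x, x, x),
      (ContinuousAt (fun q : M × M ↦ (⟨q.1, Ψ q.1 q.2⟩ : TotalSpace F₁ ξ)) (q.1, q.2.1) ∧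
        (Ψ q.1 q.2.1 = Ψ q.1 q.2.2 → q.2.1 = q.2.2)) ∧
      ContinuousAt (fun q : M × N ↦ (⟨f q.1, Φ q.1 q.2⟩ : TotalSpace F₃ η)) (q.1, f q.2.1) ∧
        (Φ q.1 (f q.2.1) = Φ q.1 (f q.2.2) → f q.2.1 = f q.2.2) := by
    have h1 : Tendsto (fun q : M × M × M ↦ (q.1, q.2.1)) (𝓝 (x, x, x)) (𝓝 (x, x)) :=
      (by fun_prop : Continuous fun q : M × M × M ↦ (q.1, q.2.1)).tendsto _
    have h2 : Tendsto (fun q : M × M × M ↦ (q.1, f q.2.1)) (𝓝 (x, x, x)) (𝓝 (x, f x)) :=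
      (by fun_prop : Continuous fun q : M × M × M ↦ (q.1, f q.2.1)).tendsto _
    have h3 : Tendsto (fun q : M × M × M ↦ (q.1, f q.2.1, f q.2.2)) (𝓝 (x, x, x))
        (𝓝 (x, f x, f x)) :=
      (by fun_prop : Continuous fun q : M × M × M ↦ (q.1, f q.2.1, f q.2.2)).tendsto _
    filter_upwards [h1.eventually (hΨ.eventually_continuousAt x), hΨ.eventually_injective x,
      h2.eventually (hΦ.eventually_continuousAt x), h3.eventually (hΦ.eventually_injective x)]
      with q a b c d
    exact ⟨⟨a, b⟩, c, d⟩
  obtain ⟨δ, hδ, hδr, hP⟩ := exists_edist_le_of_eventually (P := fun x z z' ↦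
      (ContinuousAt (fun q : M × M ↦ (⟨q.1, Ψ q.1 q.2⟩ : TotalSpace F₁ ξ)) (x, z) ∧
        (Ψ x z = Ψ x z' → z = z')) ∧
      ContinuousAt (fun q : M × N ↦ (⟨f q.1, Φ q.1 q.2⟩ : TotalSpace F₃ η)) (x, f z) ∧
        (Φ x (f z) = Φ x (f z') → f z = f z')) hev
    (ENNReal.half_pos (ENNReal.ofReal_pos.2 hr).ne')
  obtain ⟨ε, hε, Z, hZc, hZ⟩ := exists_continuousOn_inverse hΨ hδ
    (fun x z hz ↦ (hP x z z hz hz).1.1) (fun x z z' hz hz' ↦ (hP x z z' hz hz').1.2)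
    (fun x ↦ LinearMap.fst ℝ (ξ x) (ζ x) ∘ₗ G x) hG₁
  -- the factor that moves the points of a configuration into the ball of radius `ε`
  let scale : Conf (EuclideanSpace ℝ (Fin L)) k → ℝ := fun c ↦ ε / (1 + ∑ i, ‖c.1 i‖)
  have hden (c : Conf (EuclideanSpace ℝ (Fin L)) k) : 0 < 1 + ∑ i, ‖c.1 i‖ := by positivity
  have hscale (c) : 0 < scale c := div_pos hε (hden c)
  let u : Conf (EuclideanSpace ℝ (Fin L)) k → Fin k → EuclideanSpace ℝ (Fin L) :=
    fun c i ↦ scale c • c.1 i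
  have hu (c i) : ‖u c i‖ < ε := by
    rw [norm_smul, Real.norm_of_nonneg (hscale c).le, div_mul_eq_mul_div, div_lt_iff₀ (hden c)]
    refine mul_lt_mul_of_pos_left ?_ hε
    have := Finset.single_le_sum (f := fun i ↦ ‖c.1 i‖) (fun i _ ↦ norm_nonneg _)
      (Finset.mem_univ i)
    linarith
  have huinj (c) : Function.Injective (u c) := fun i j h ↦
    c.2 (smul_right_injective _ (hscale c).ne' h)
  have huc (i) : Continuous fun c ↦ u c i := by
    refine Continuous.smul (continuous_const.div (continuous_const.add
      (continuous_finsetSum _ fun i _ ↦ (continuous_conf_apply i).norm)) fun c ↦ (hden c).ne')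
      (continuous_conf_apply i)
  have huσ (σ : Equiv.Perm (Fin k)) (c i) : u (σ • c) i = u c (σ⁻¹ i) := by
    have : ∑ i, ‖(σ • c).1 i‖ = ∑ i, ‖c.1 i‖ := Equiv.sum_comp σ⁻¹ fun i ↦ ‖c.1 i‖
    simp only [u, scale, this]
    rfl
  have huq (i) : Continuous fun q : M × Conf (EuclideanSpace ℝ (Fin L)) k ↦ (q.1, u q.2 i) :=
    continuous_fst.prodMk ((huc i).comp continuous_snd)
  have hZq (i) : Continuous fun q : M × Conf (EuclideanSpace ℝ (Fin L)) k ↦ Z (q.1, u q.2 i) :=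
    hZc.comp_continuous (huq i) fun q ↦ hu q.2 i
  refine hasNowhereZeroSection_of_equivariant
    (fun x c i ↦ ((Φ x (f (Z (x, u c i))), (G x (u c i)).2) : η (f x) × ζ x)) (fun i ↦ ?_)
    (fun σ x c i ↦ by rw [huσ]) fun x c ↦ ?_
  · rw [(FiberBundle.Prod.isInducing_diag F₃ ((f : M → N) *ᵖ η) F₂ ζ).continuous_iff]
    refine Continuous.prodMk ?_ (hG₂.comp (huq i))
    rw [(inducing_pullbackTotalSpaceEmbedding F₃ η f).continuous_iff]
    refine continuous_fst.prodMk (continuous_iff_continuousAt.2 fun q ↦ ?_)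
    have hq := hP q.1 _ _ (hZ q.1 _ (hu q.2 i)).1 (hZ q.1 _ (hu q.2 i)).1
    exact ContinuousAt.comp
      (f := fun q : M × Conf (EuclideanSpace ℝ (Fin L)) k ↦ (q.1, f (Z (q.1, u q.2 i))))
      hq.2.1 (continuous_fst.prodMk (f.continuous.comp (hZq i))).continuousAt
  · by_contra! hall
    have hf (i j) : f (Z (x, u c i)) = f (Z (x, u c j)) :=
      (hP x _ _ (hZ x _ (hu c i)).1 (hZ x _ (hu c j)).1).2.2 (Prod.mk.inj (hall i j)).1
    have hinj : Function.Injective fun i ↦ Z (x, u c i) := by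
      intro i j hij
      have h₂ : (G x (u c i)).2 = (G x (u c j)).2 := (Prod.mk.inj (hall i j)).2
      refine huinj c (hGinj x (Prod.ext ?_ h₂))
      have h := congrArg (Ψ x) hij
      simp only [(hZ x _ (hu c _)).2] at h
      exact h
    refine absurd (hno _ hinj hf) (not_le.2 (lt_of_le_of_lt (Metric.ediam_le
      (d := δ + δ) ?_) ((ENNReal.add_lt_add hδr hδr).trans_eq (ENNReal.add_halves _))))
    rintro _ ⟨i, rfl⟩ _ ⟨j, rfl⟩
    refine (edist_triangle_left _ _ x).trans (add_le_add ?_ ?_)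
    · exact (hZ x _ (hu c i)).1
    · exact (hZ x _ (hu c j)).1

end LocalMultiplicity

theorem theorem3p2 (k : ℕ) (hk : 2 ≤ k) (m n : ℕ)
    -- a compact Riemannian manifold `M` of dimension `m`
    {M : Type*} [EMetricSpace M] [ChartedSpace (EuclideanSpace ℝ (Fin m)) M]
    [IsManifold (𝓡 m) ∞ M] [RiemannianBundle (fun x : M ↦ TangentSpace (𝓡 m) x)]
    [IsContMDiffRiemannianBundle (𝓡 m) ∞ (EuclideanSpace ℝ (Fin m))
      (fun x : M ↦ TangentSpace (𝓡 m) x)]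
    [IsRiemannianManifold (𝓡 m) M] [CompactSpace M]
    -- a Riemannian manifold `N` of dimension `n` with positive injectivity radius
    {N : Type*} [EMetricSpace N] [ChartedSpace (EuclideanSpace ℝ (Fin n)) N]
    [IsManifold (𝓡 n) ∞ N] [RiemannianBundle (fun y : N ↦ TangentSpace (𝓡 n) y)]
    [IsContMDiffRiemannianBundle (𝓡 n) ∞ (EuclideanSpace ℝ (Fin n))
      (fun y : N ↦ TangentSpace (𝓡 n) y)]
    [IsRiemannianManifold (𝓡 n) N]
    (hN : 0 < LocalMultiplicity.injectivityRadius (𝓡 n) N)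
    (f : C(M, N))
    -- an inverse bundle `ζ = -τM` of the tangent bundle of `M`, of finite rank
    {F : Type*} [NormedAddCommGroup F] [NormedSpace ℝ F] [FiniteDimensional ℝ F]
    {ζ : M → Type*} [∀ x, AddCommGroup (ζ x)] [∀ x, Module ℝ (ζ x)]
    [∀ x, TopologicalSpace (ζ x)] [TopologicalSpace (TotalSpace F ζ)]
    [FiberBundle F ζ] [VectorBundle ℝ F ζ]
    (hζ : LocalMultiplicity.IsInverseBundle (m + Module.finrank ℝ F)
      (EuclideanSpace ℝ (Fin m)) (fun x : M ↦ TangentSpace (𝓡 m) x) F ζ)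
    -- the quotient bundle `p₁^*((f^*τN ⊕ -τM) ⊗ W_k) / S_k` over
    -- `M × Conf(ℝ ^ (dim τM + dim (-τM)), k) / S_k` has no nowhere zero section
    (hs : ¬ LocalMultiplicity.HasNowhereZeroSection k
      (((f : M → N) *ᵖ (fun y : N ↦ TangentSpace (𝓡 n) y)) ×ᵇ ζ)
      (EuclideanSpace ℝ (Fin n) × F)
      (EuclideanSpace ℝ (Fin (m + Module.finrank ℝ F)))) :
    LocalMultiplicity.AdmitsLocalMultiplicity k f := by
  obtain ⟨Ψ, hΨ⟩ := LocalMultiplicity.exists_isFibrewiseCoord_tangentSpace (𝓡 m) (N := M)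
    continuous_id
  obtain ⟨Φ, hΦ⟩ := LocalMultiplicity.exists_isFibrewiseCoord_tangentSpace (𝓡 n) f.continuous
  exact LocalMultiplicity.admitsLocalMultiplicity_of_isFibrewiseCoord f
    (ξ := fun x : M ↦ TangentSpace (𝓡 m) x) (Ψ := Ψ) hΨ hΦ hζ hs
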